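/- For complex $p\times q$ matrices $A,B$ let $\operatorname{nrank}(A,B)=\max_{\zeta\in\mathbb C}\operatorname{rank}(A-\zeta B)$. A number $\lambda_0\in\mathbb C$ is an eigenvalue of the pencil $A-\lambda B$ if $\operatorname{rank}(A-\lambda_0B)<\operatorname{nrank}(A,B)$, and $\infty$ is an eigenvalue if $\operatorname{rank}(B)<\operatorname{nrank}(A,B)$. A square pencil is called singular if $\det(A-\lambda B)\equiv 0$ and regular otherwise. A set $\Omega\subseteq\mathbb C^{n,k}$ is called generic if, under the identification $\mathbb C^{n,k}\cong\mathbb R^{2nk}$ by real and imaginary parts of the entries, its complement is contained in the set of common zeros of finitely many real polynomials, this zero set not being all of $\mathbb R^{2nk}$. Let $A-\lambda B$ be a complex $n\times n$ singular pencil of normal rank $n-k$, and let $D_A,D_B\in\mathbb C^{k,k}$ be diagonal matrices such that $D_A-\lambda D_B$ is regular and has no eigenvalue (finite or infinite) in common with $A-\lambda B$. Then there exists a generic set $\Omega_2\subseteq\mathbb C^{n,k}$ such that for each $U\in\Omega_2$ there exists a generic set $\Omega_3\subseteq\mathbb C^{n,k}$ such that for all $V\in\Omega_3$ and all $\tau\in\mathbb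 C\setminus\{0\}$ the perturbed pencil $\widetilde A-\lambda\widetilde B$, where $\widetilde A=A+\tau UD_AV^*$ and $\widetilde B=B+\tau UD_BV^*$, has the following properties. 1. Let $\lambda_0\in\mathbb C$ be a finite eigenvalue of $A-\lambda B$ and let $d\ge1$. (a) If $x_d$ is a right root vector of height $d$ for $\lambda_0$, i.e., there are nonzero vectors $x_1,\dots,x_d$ with $(\widetilde A-\lambda_0\widetilde B)x_1=0$ and $(\widetilde A-\lambda_0\widetilde B)x_{i+1}=\widetilde Bx_i$ for $i=1,\dots,d-1$, then $V^*x_d=0$. (b) If $y_d$ is a left root vector of height $d$ for $\lambda_0$, i.e., there are nonzero vectors $y_1,\dots,y_d$ with $y_1^*(\widetilde A-\lambda_0\widetilde B)=0$ and $y_{i+1}^*(\widetilde A-\lambda_0\widetilde B)=y_i^*\widetilde B$ for $i=1,\dots,d-1$, then $U^*y_d=0$. 2. Let $\infty$ be an eigenvalue of $A-\lambda B$ and let $d\ge1$. (a) If $x_d$ is a right root vector of height $d$ for $\infty$, i.e., there are nonzero vectors $x_1,\dots,x_d$ with $\widetilde Bx_1=0$ and $\widetilde Bx_{i+1}=\widetilde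 Ax_i$ for $i=1,\dots,d-1$, then $V^*x_d=0$. (b) If $y_d$ is a left root vector of height $d$ for $\infty$, i.e., there are nonzero vectors $y_1,\dots,y_d$ with $y_1^*\widetilde B=0$ and $y_{i+1}^*\widetilde B=y_i^*\widetilde A$ for $i=1,\dots,d-1$, then $U^*y_d=0$. -/

import Mathlib

open scoped Matrix

namespace MatrixPencil

/-! The pencil `A - λ B` is represented by the pair of its coefficient matrices `A`, `B`. -/

/-- The normal rank of `A - λ B`: the maximum over `ζ : ℂ` of `rank (A - ζ B)`
(these ranks are bounded by the number of columns, so the supremum in `ℕ` is attained). -/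
noncomputable def normalRank {m n : ℕ} (A B : Matrix (Fin m) (Fin n) ℂ) : ℕ :=
  ⨆ ζ : ℂ, (A - ζ • B).rank

/-- A square pencil is regular if `det (A - λ B)` is not identically zero. -/
def IsRegularPencil {n : ℕ} (A B : Matrix (Fin n) (Fin n) ℂ) : Prop :=
  ∃ ζ : ℂ, (A - ζ • B).det ≠ 0

/-- A square pencil is singular if `det (A - λ B)` vanishes identically. -/
def IsSingularPencil {n : ℕ} (A B : Matrix (Fin n) (Fin n) ℂ) : Prop :=
  ∀ ζ : ℂ, (A - ζ • B).det = 0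

/-- `μ : ℂ` is a finite eigenvalue of the (possibly singular) pencil `A - λ B`. -/
def IsFiniteEigenvalue {m n : ℕ} (A B : Matrix (Fin m) (Fin n) ℂ) (μ : ℂ) : Prop :=
  (A - μ • B).rank < normalRank A B

/-- `∞` is an eigenvalue of the (possibly singular) pencil `A - λ B`. -/
def IsInfiniteEigenvalue {m n : ℕ} (A B : Matrix (Fin m) (Fin n) ℂ) : Prop :=
  B.rank < normalRank A B

/-- No element of `ℂ ∪ {∞}` is an eigenvalue of both pencils. -/
def DisjointEigenvalues {m n p q : ℕ} (A B : Matrix (Fin m) (Fin n) ℂ)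
    (C D : Matrix (Fin p) (Fin q) ℂ) : Prop :=
  (∀ μ : ℂ, ¬ (IsFiniteEigenvalue A B μ ∧ IsFiniteEigenvalue C D μ)) ∧
    ¬ (IsInfiniteEigenvalue A B ∧ IsInfiniteEigenvalue C D)

/-- `x` is a right root vector of height `d` (meant for `1 ≤ d`) of `A - λ B` for `μ : ℂ`:
it is the last member `c d` of a chain of nonzero vectors `c 1, …, c d` with
`(A - μ B) c₁ = 0` and `(A - μ B) cᵢ₊₁ = B cᵢ`. -/
def IsRightRootVector {n : ℕ} (A B : Matrix (Fin n) (Fin n) ℂ) (μ : ℂ) (d : ℕ)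
    (x : Fin n → ℂ) : Prop :=
  ∃ c : ℕ → Fin n → ℂ, c d = x ∧ (∀ i, 1 ≤ i → i ≤ d → c i ≠ 0) ∧
    (A - μ • B) *ᵥ c 1 = 0 ∧
    ∀ i, 1 ≤ i → i < d → (A - μ • B) *ᵥ c (i + 1) = B *ᵥ c i

/-- `y` is a left root vector of height `d` (meant for `1 ≤ d`) of `A - λ B` for `μ : ℂ`:
it is the last member of a chain of nonzero vectors with
`c₁^* (A - μ B) = 0` and `cᵢ₊₁^* (A - μ B) = cᵢ^* B`. -/
def IsLeftRootVector {n : ℕ} (A B : Matrix (Fin n) (Fin n) ℂ) (μ : ℂ) (d : ℕ)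
    (y : Fin n → ℂ) : Prop :=
  ∃ c : ℕ → Fin n → ℂ, c d = y ∧ (∀ i, 1 ≤ i → i ≤ d → c i ≠ 0) ∧
    star (c 1) ᵥ* (A - μ • B) = 0 ∧
    ∀ i, 1 ≤ i → i < d → star (c (i + 1)) ᵥ* (A - μ • B) = star (c i) ᵥ* B

/-- `x` is a right root vector of height `d` (meant for `1 ≤ d`) of `A - λ B` for `∞`:
`B c₁ = 0` and `B cᵢ₊₁ = A cᵢ` along the chain. -/
def IsRightRootVectorInfty {n : ℕ} (A B : Matrix (Fin n) (Fin n) ℂ) (d : ℕ)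
    (x : Fin n → ℂ) : Prop :=
  ∃ c : ℕ → Fin n → ℂ, c d = x ∧ (∀ i, 1 ≤ i → i ≤ d → c i ≠ 0) ∧
    B *ᵥ c 1 = 0 ∧
    ∀ i, 1 ≤ i → i < d → B *ᵥ c (i + 1) = A *ᵥ c i

/-- `y` is a left root vector of height `d` (meant for `1 ≤ d`) of `A - λ B` for `∞`:
`c₁^* B = 0` and `cᵢ₊₁^* B = cᵢ^* A` along the chain. -/
def IsLeftRootVectorInfty {n : ℕ} (A B : Matrix (Fin n) (Fin n) ℂ) (d : ℕ)
    (y : Fin n → ℂ) : Prop :=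
  ∃ c : ℕ → Fin n → ℂ, c d = y ∧ (∀ i, 1 ≤ i → i ≤ d → c i ≠ 0) ∧
    star (c 1) ᵥ* B = 0 ∧
    ∀ i, 1 ≤ i → i < d → star (c (i + 1)) ᵥ* B = star (c i) ᵥ* A

/-- One coefficient of the perturbed pencil: `A + τ U D V^*`. -/
noncomputable def perturb {n k : ℕ} (A : Matrix (Fin n) (Fin n) ℂ) (τ : ℂ)
    (U : Matrix (Fin n) (Fin k) ℂ) (D : Matrix (Fin k) (Fin k) ℂ)
    (V : Matrix (Fin n) (Fin k) ℂ) : Matrix (Fin n) (Fin n) ℂ :=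
  A + τ • (U * D * Vᴴ)

/-- A subset of `ℝ^σ` is algebraic if it is the set of common zeros of finitely many
polynomials. -/
def IsAlgebraicSet {σ : Type*} (S : Set (σ → ℝ)) : Prop :=
  ∃ P : Finset (MvPolynomial σ ℝ), S = {x | ∀ p ∈ P, MvPolynomial.eval x p = 0}

/-- A subset of `ℝ^σ` is generic if its complement is contained in a proper algebraic subset. -/
def IsGenericReal {σ : Type*} (Ω : Set (σ → ℝ)) : Prop :=
  ∃ S : Set (σ → ℝ), IsAlgebraicSet S ∧ S ≠ Set.univ ∧ Ωᶜ ⊆ S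

/-- The canonical identification of complex `n × k` matrices with real vectors of length `2nk`,
by real parts (`Sum.inl`) and imaginary parts (`Sum.inr`) of the entries. -/
def realCoords (n k : ℕ) :
    Matrix (Fin n) (Fin k) ℂ ≃ ((Fin n × Fin k) ⊕ (Fin n × Fin k) → ℝ) where
  toFun M := Sum.elim (fun p => (M p.1 p.2).re) (fun p => (M p.1 p.2).im)
  invFun v := Matrix.of fun i j => ⟨v (Sum.inl (i, j)), v (Sum.inr (i, j))⟩
  left_inv M := by
    ext i j
    rfl
  right_inv v := by
    funext s
    cases s <;> rfl

/-- A set of complex matrices is generic if it is identified with a generic subset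
of `ℝ^(2nk)`. -/
def IsGeneric {n k : ℕ} (Ω : Set (Matrix (Fin n) (Fin k) ℂ)) : Prop :=
  IsGenericReal (realCoords n k '' Ω)

end MatrixPencil

open MatrixPencil

/-! Move the eigenvalue to `0` (for `∞`, swap the two coefficients), so that the pencil is `S - X
T`, of rank at most `n - k` for every value of `X`. It then has `k` polynomial left null vectors,
the rows of `N`, with `N(0)` of full row rank (`exists_polynomial_left_kernel`). For generic `U` the
matrix `N(0) U` is invertible.

Encode a chain as `c(X) = ∑ X^i c_{i+1}`, `i < d`. The perturbed pencil sends `c(X)` to a multiple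
of `X^d`. Multiplying by `N` removes the unperturbed part, so `τ N U (D - X E) V^* c(X)` is
divisible by `X^d`. At `X = 0` the matrix `N U (D - X E)` is invertible because the eigenvalue is
not one of the diagonal pencil. Hence `X^d` divides `V^* c(X)`, whose top coefficient is `V^* c_d`
(`conjTranspose_mulVec_eq_zero_of_chain`).

Left chains follow by conjugate transposition, which exchanges `U` and `V`. There are finitely many
eigenvalues, so one product of polynomials serves them all. -/

/-- A family of columns, independent over a domain, has a left inverse up to a nonzero scalar. -/
theorem exists_mul_eq_smul_one_of_linearIndependent_col {R : Type*} [CommRing R] [IsDomain R]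
    {m r : ℕ} (Q : Matrix (Fin m) (Fin r) R) (hQ : LinearIndependent R Q.col) :
    ∃ (W : Matrix (Fin r) (Fin m) R) (d : R), d ≠ 0 ∧ W * Q = d • 1 := by
  classical
  let F := FractionRing R
  let φ : (Fin m → R) →ₗ[R] (Fin m → F) := (Algebra.linearMap R F).compLeft (Fin m)
  have hφ : Function.Injective φ := by
    intro x y h
    funext i
    exact IsFractionRing.injective R F (congrFun h i)
  have h1 : LinearIndependent R (φ ∘ Q.col) := hQ.map' φ (LinearMap.ker_eq_bot.2 hφ)
  rw [LinearIndependent.iff_fractionRing R F] at h1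
  have h2 : Function.Injective (Q.map (algebraMap R F)).mulVec :=
    Matrix.mulVec_injective_iff.2 h1
  obtain ⟨g, hg⟩ := LinearMap.exists_leftInverse_of_injective
    (Q.map (algebraMap R F)).mulVecLin (LinearMap.ker_eq_bot.2 h2)
  let G : Matrix (Fin r) (Fin m) F := LinearMap.toMatrix' g
  have hG : G * Q.map (algebraMap R F) = 1 := by
    have := congrArg LinearMap.toMatrix' hg
    rw [LinearMap.toMatrix'_comp, LinearMap.toMatrix'_id] at this
    rw [← this]
    congr 1
    exact (LinearMap.toMatrix'_toLin' _).symm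
  -- A common denominator `b` of the left inverse over the fraction field becomes the scalar `d`.
  obtain ⟨b, hb⟩ := IsLocalization.exist_integer_multiples_of_finite (nonZeroDivisors R)
    (fun p : Fin r × Fin m => G p.1 p.2)
  choose w hw using hb
  refine ⟨Matrix.of fun i j => w (i, j), b, nonZeroDivisors.coe_ne_zero b, ?_⟩
  have hinj : Function.Injective (fun M : Matrix (Fin r) (Fin r) R => M.map (algebraMap R F)) :=
    Matrix.map_injective (IsFractionRing.injective R F)
  apply hinj
  have hW : (Matrix.of fun i j => w (i, j)).map (algebraMap R F) = (b : R) • G := by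
    ext i j
    exact hw (i, j)
  simp only [Matrix.map_mul, hW, Matrix.smul_mul, hG]
  ext i j
  simp [Matrix.one_apply, Matrix.smul_apply, Algebra.smul_def, Matrix.algebraMap_matrix_apply,
    apply_ite (algebraMap R F)]

/-- Over a domain, a matrix of rank `r` can be compressed to a nonzero scalar matrix
of size `r`. -/
theorem exists_mul_mul_eq_smul_one {R : Type*} [CommRing R] [IsDomain R]
    {m n : ℕ} (M : Matrix (Fin m) (Fin n) R) :
    ∃ (W : Matrix (Fin M.rank) (Fin m) R) (G : Matrix (Fin n) (Fin M.rank) R) (d : R),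
      d ≠ 0 ∧ W * M * G = d • 1 := by
  classical
  obtain ⟨f, hf⟩ := exists_linearIndependent_of_le_finrank (R := R)
    (M := LinearMap.range M.mulVecLin) (le_refl M.rank)
  choose g hg using fun i => (f i).2
  let G : Matrix (Fin n) (Fin M.rank) R := Matrix.of fun i j => g j i
  have hcol : (M * G).col = fun i => (f i : Fin m → R) := by
    funext i
    rw [← hg i]
    rfl
  have hind : LinearIndependent R (M * G).col := by
    rw [hcol]
    exact hf.map' (Submodule.subtype _) (Submodule.ker_subtype _)
  obtain ⟨W, d, hd, h⟩ := exists_mul_eq_smul_one_of_linearIndependent_col (M * G) hind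
  exact ⟨W, G, d, hd, by rw [Matrix.mul_assoc, h]⟩

theorem le_rank_of_det_mul_mul_ne_zero {K : Type*} [Field K] {m n r : ℕ}
    (W : Matrix (Fin r) (Fin m) K) (M : Matrix (Fin m) (Fin n) K) (G : Matrix (Fin n) (Fin r) K)
    (h : (W * M * G).det ≠ 0) : r ≤ M.rank := by
  have h1 := Matrix.rank_of_isUnit (W * M * G)
    ((Matrix.isUnit_iff_isUnit_det _).2 (isUnit_iff_ne_zero.2 h))
  rw [Fintype.card_fin] at h1
  rw [← h1]
  exact (Matrix.rank_mul_le_left _ _).trans (Matrix.rank_mul_le_right _ _)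

namespace MatrixPencil

open Polynomial

/-! ### Normal rank and polynomial null vectors -/

/-- The matrix polynomial `A - X B`. -/
noncomputable def toPoly {m n : ℕ} (A B : Matrix (Fin m) (Fin n) ℂ) :
    Matrix (Fin m) (Fin n) ℂ[X] :=
  A.map C - (X : ℂ[X]) • B.map C

theorem toPoly_map_eval {m n : ℕ} (A B : Matrix (Fin m) (Fin n) ℂ) (ζ : ℂ) :
    (toPoly A B).map (evalRingHom ζ) = A - ζ • B := by
  ext i j
  simp [toPoly]
  exact mul_comm _ _

theorem bddAbove_rank {m n : ℕ} (A B : Matrix (Fin m) (Fin n) ℂ) :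
    BddAbove (Set.range fun ζ : ℂ => (A - ζ • B).rank) := by
  refine ⟨n, ?_⟩
  rintro _ ⟨ζ, rfl⟩
  exact Matrix.rank_le_width _

theorem rank_le_normalRank {m n : ℕ} (A B : Matrix (Fin m) (Fin n) ℂ) (ζ : ℂ) :
    (A - ζ • B).rank ≤ normalRank A B :=
  le_ciSup (bddAbove_rank A B) ζ

theorem exists_rank_eq_normalRank {m n : ℕ} (A B : Matrix (Fin m) (Fin n) ℂ) :
    ∃ ζ : ℂ, (A - ζ • B).rank = normalRank A B :=
  Nat.sSup_mem (Set.range_nonempty _) (bddAbove_rank A B)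

/-- Compress the pencil where its rank is maximal: the determinant of the compression is a
polynomial in the parameter, nonzero there, and every eigenvalue is a root of it. -/
theorem finite_setOf_isFiniteEigenvalue {m n : ℕ} (A B : Matrix (Fin m) (Fin n) ℂ) :
    {μ : ℂ | IsFiniteEigenvalue A B μ}.Finite := by
  obtain ⟨ζ, hζ⟩ := exists_rank_eq_normalRank A B
  obtain ⟨W, G, d, hd, h⟩ := exists_mul_mul_eq_smul_one (A - ζ • B)
  have key : ∀ μ : ℂ, (W.map C * toPoly A B * G.map C).det.eval μ =
      (W * (A - μ • B) * G).det := by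
    intro μ
    have hC : ∀ {p q : ℕ} (M : Matrix (Fin p) (Fin q) ℂ),
        (M.map C).map (evalRingHom μ) = M := by
      intro p q M
      ext i j
      simp
    rw [← coe_evalRingHom, RingHom.map_det, RingHom.mapMatrix_apply, Matrix.map_mul,
      Matrix.map_mul, toPoly_map_eval, hC, hC]
  have hp : (W.map C * toPoly A B * G.map C).det ≠ 0 := by
    intro h0
    have := key ζ
    rw [h0, h, eval_zero, Matrix.det_smul, Matrix.det_one, mul_one] at this
    exact pow_ne_zero _ hd this.symm
  refine (Polynomial.finite_setOfPred_isRoot hp).subset fun μ hμ => ?_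
  by_contra hroot
  have hroot' : (W * (A - μ • B) * G).det ≠ 0 := by
    rw [← key]
    exact hroot
  have := le_rank_of_det_mul_mul_ne_zero W (A - μ • B) G hroot'
  rw [hζ] at this
  exact absurd (Set.mem_ofPred.1 hμ) (not_lt.2 this)

/-- The compression of `toPoly A B` to `d • 1` survives evaluation at any point where `d` does not
vanish. -/
theorem exists_rank_toPoly_le {m n : ℕ} (A B : Matrix (Fin m) (Fin n) ℂ) :
    ∃ ζ : ℂ, (toPoly A B).rank ≤ (A - ζ • B).rank := by
  obtain ⟨W, G, d, hd, h⟩ := exists_mul_mul_eq_smul_one (toPoly A B)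
  obtain ⟨ζ, hζ⟩ : ∃ ζ, d.eval ζ ≠ 0 := by
    by_contra hcon
    push Not at hcon
    exact hd (Polynomial.funext fun r => by simp [hcon r])
  refine ⟨ζ, le_rank_of_det_mul_mul_ne_zero (W.map (evalRingHom ζ)) _ (G.map (evalRingHom ζ)) ?_⟩
  rw [← toPoly_map_eval, ← Matrix.map_mul, ← Matrix.map_mul, h, ← RingHom.mapMatrix_apply,
    ← RingHom.map_det, Matrix.det_smul, Matrix.det_one, mul_one, map_pow]
  exact pow_ne_zero _ hζ

/-- A pencil of normal rank at most `n - k` has `k` polynomial right null vectors whose values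
at `0` are linearly independent. -/
theorem exists_polynomial_kernel {m n k : ℕ} (A B : Matrix (Fin m) (Fin n) ℂ)
    (hk : ∀ ζ : ℂ, (A - ζ • B).rank + k ≤ n) :
    ∃ N : Matrix (Fin n) (Fin k) ℂ[X], toPoly A B * N = 0 ∧
      LinearIndependent ℂ (N.map (evalRingHom 0)).col := by
  classical
  let K := LinearMap.ker (toPoly A B).mulVecLin
  have hrk : k ≤ Module.finrank ℂ[X] K := by
    obtain ⟨ζ, hζ⟩ := exists_rank_toPoly_le A B
    have h1 := Submodule.finrank_quotient_add_finrank K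
    rw [(toPoly A B).mulVecLin.quotKerEquivRange.finrank_eq] at h1
    rw [Module.finrank_fin_fun] at h1
    have h2 := hk ζ
    have h3 : (toPoly A B).rank = Module.finrank ℂ[X] (LinearMap.range (toPoly A B).mulVecLin) :=
      rfl
    omega
  let b := Module.finBasis ℂ[X] K
  let N : Matrix (Fin n) (Fin k) ℂ[X] := Matrix.of fun i j => (b (Fin.castLE hrk j) : Fin n → ℂ[X]) i
  refine ⟨N, ?_, ?_⟩
  · refine Matrix.ext fun i j => ?_
    exact congrFun (LinearMap.mem_ker.1 (b (Fin.castLE hrk j)).2) i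
  · rw [Fintype.linearIndependent_iff]
    intro g hg j
    -- A relation among the values at `0` makes `v` divisible by `X`. The kernel is closed under
    -- division by `X`, so the coordinates `C (g j)` of `v` in the basis are divisible by `X`, hence
    -- zero.
    let v : K := ∑ j, C (g j) • b (Fin.castLE hrk j)
    have hv0 : ∀ i, ((v : Fin n → ℂ[X]) i).eval 0 = 0 := by
      intro i
      have := congrFun hg i
      simpa [v, N, Polynomial.eval_finsetSum, Matrix.col] using this
    choose w hw using fun i => X_dvd_iff.2 ((coeff_zero_eq_eval_zero _).trans (hv0 i))
    have hvw : (v : Fin n → ℂ[X]) = (X : ℂ[X]) • w := by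
      funext i
      exact hw i
    have hwK : w ∈ K := by
      have h := LinearMap.mem_ker.1 v.2
      rw [hvw, map_smul] at h
      exact LinearMap.mem_ker.2 ((smul_eq_zero.1 h).resolve_left X_ne_zero)
    have hveq : v = (X : ℂ[X]) • (⟨w, hwK⟩ : K) := Subtype.ext hvw
    have h1 : b.repr v (Fin.castLE hrk j) = C (g j) := by
      simp only [v, map_sum, map_smul, Module.Basis.repr_self, Finsupp.coe_finsetSum,
        Finset.sum_apply, Finsupp.smul_apply, Finsupp.single_apply, (Fin.castLE_injective hrk).eq_iff]
      simp
    rw [hveq, map_smul, Finsupp.smul_apply, smul_eq_mul] at h1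
    have := congrArg (Polynomial.eval 0) h1
    simpa using this.symm

theorem exists_polynomial_left_kernel {m n k : ℕ} (A B : Matrix (Fin m) (Fin n) ℂ)
    (hk : ∀ ζ : ℂ, (A - ζ • B).rank + k ≤ m) :
    ∃ N : Matrix (Fin k) (Fin m) ℂ[X], N * toPoly A B = 0 ∧
      ∃ W : Matrix (Fin m) (Fin k) ℂ, (N.map (evalRingHom 0) * W).det ≠ 0 := by
  obtain ⟨N, hN, hind⟩ := exists_polynomial_kernel (k := k) Aᵀ Bᵀ (fun ζ => by
    rw [← Matrix.transpose_smul, ← Matrix.transpose_sub, Matrix.rank_transpose]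
    exact hk ζ)
  obtain ⟨W, d, hd, hW⟩ := exists_mul_eq_smul_one_of_linearIndependent_col _ hind
  refine ⟨Nᵀ, ?_, Wᵀ, ?_⟩
  · have : toPoly A B = (toPoly Aᵀ Bᵀ)ᵀ := rfl
    rw [this, ← Matrix.transpose_mul, hN, Matrix.transpose_zero]
  · rw [Matrix.transpose_map, ← Matrix.transpose_mul, hW, Matrix.det_transpose,
      Matrix.det_smul, Matrix.det_one, mul_one]
    exact pow_ne_zero _ hd

/-! ### Chains as truncated polynomials -/

theorem toPoly_perturb {n k : ℕ} (A B : Matrix (Fin n) (Fin n) ℂ) (τ : ℂ)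
    (U V : Matrix (Fin n) (Fin k) ℂ) (D E : Matrix (Fin k) (Fin k) ℂ) :
    toPoly (perturb A τ U D V) (perturb B τ U E V) =
      toPoly A B + C τ • (U.map C * toPoly D E * Vᴴ.map C) := by
  have h : ∀ (A : Matrix (Fin n) (Fin n) ℂ) (D : Matrix (Fin k) (Fin k) ℂ),
      (perturb A τ U D V).map C = A.map C + C τ • (U.map C * D.map C * Vᴴ.map C) := by
    intro A D
    rw [← Matrix.map_mul, ← Matrix.map_mul]
    refine Matrix.ext fun i j => ?_
    simp [perturb, -Matrix.map_mul]
  simp only [toPoly, h, Matrix.mul_sub, Matrix.sub_mul, smul_sub, smul_add, Matrix.mul_smul,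
    Matrix.smul_mul, smul_comm (X : ℂ[X]) (C τ)]
  abel

/-- The polynomial `∑ i ≤ e, X ^ i • c (i + 1)` with vector coefficients attached to a chain. -/
noncomputable def chainPoly {n : ℕ} (c : ℕ → Fin n → ℂ) (e : ℕ) : Fin n → ℂ[X] :=
  ∑ i ∈ Finset.range (e + 1), (X : ℂ[X]) ^ i • (C ∘ c (i + 1))

theorem map_C_mulVec {m n : ℕ} (M : Matrix (Fin m) (Fin n) ℂ) (v : Fin n → ℂ) :
    M.map C *ᵥ (C ∘ v) = C ∘ (M *ᵥ v) := by
  funext i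
  exact (RingHom.map_mulVec C M v i).symm

theorem map_C_mulVec_chainPoly {m n : ℕ} (M : Matrix (Fin m) (Fin n) ℂ) (c : ℕ → Fin n → ℂ)
    (e : ℕ) : M.map C *ᵥ chainPoly c e = chainPoly (fun i => M *ᵥ c i) e := by
  simp only [chainPoly, Matrix.mulVec_sum, Matrix.mulVec_smul, map_C_mulVec]

theorem coeff_chainPoly {n : ℕ} (c : ℕ → Fin n → ℂ) {e i : ℕ} (hi : i < e + 1) (j : Fin n) :
    (chainPoly c e j).coeff i = c (i + 1) j := by
  simp only [chainPoly, Finset.sum_apply, Pi.smul_apply, Function.comp_apply, smul_eq_mul,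
    finsetSum_coeff, coeff_mul_C, coeff_X_pow, ite_mul, one_mul, zero_mul]
  rw [Finset.sum_ite_eq, if_pos (Finset.mem_range.2 hi)]

/-- The chain relations make the sum telescope, leaving only the last `T` term. -/
theorem toPoly_mulVec_chainPoly {n : ℕ} (S T : Matrix (Fin n) (Fin n) ℂ) (c : ℕ → Fin n → ℂ)
    (h1 : S *ᵥ c 1 = 0) (e : ℕ)
    (hc : ∀ i, 1 ≤ i → i < e + 1 → S *ᵥ c (i + 1) = T *ᵥ c i) :
    toPoly S T *ᵥ chainPoly c e = -((X : ℂ[X]) ^ (e + 1) • (C ∘ (T *ᵥ c (e + 1)))) := by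
  induction e with
  | zero =>
    have h0 : (C ∘ (0 : Fin n → ℂ) : Fin n → ℂ[X]) = 0 := by funext i; simp
    simp [chainPoly, toPoly, Matrix.sub_mulVec, Matrix.smul_mulVec, map_C_mulVec, h1, h0]
  | succ e ih =>
    have hs : chainPoly c (e + 1) = chainPoly c e + (X : ℂ[X]) ^ (e + 1) • (C ∘ c (e + 1 + 1)) :=
      Finset.sum_range_succ _ _
    rw [hs, Matrix.mulVec_add, ih fun i hi hi' => hc i hi (by omega), Matrix.mulVec_smul, toPoly,
      Matrix.sub_mulVec, Matrix.smul_mulVec, map_C_mulVec, map_C_mulVec,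
      hc (e + 1) (by omega) (by omega), smul_sub, smul_smul, ← pow_succ]
    abel

theorem conjTranspose_mulVec_eq_zero_of_chain {n k : ℕ} {A B : Matrix (Fin n) (Fin n) ℂ}
    {U V : Matrix (Fin n) (Fin k) ℂ} {D E : Matrix (Fin k) (Fin k) ℂ}
    {N : Matrix (Fin k) (Fin n) ℂ[X]} (hN : N * toPoly A B = 0)
    (hU : (N.map (evalRingHom 0) * U).det ≠ 0) (hD : D.det ≠ 0) {τ : ℂ} (hτ : τ ≠ 0)
    {c : ℕ → Fin n → ℂ} {d : ℕ} (hd : 1 ≤ d) (h1 : perturb A τ U D V *ᵥ c 1 = 0)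
    (hc : ∀ i, 1 ≤ i → i < d →
      perturb A τ U D V *ᵥ c (i + 1) = perturb B τ U E V *ᵥ c i) :
    Vᴴ *ᵥ c d = 0 := by
  obtain ⟨e, rfl⟩ := Nat.exists_eq_add_of_le' hd
  have h := toPoly_mulVec_chainPoly _ _ c h1 e hc
  rw [toPoly_perturb] at h
  set w := perturb B τ U E V *ᵥ c (e + 1)
  set q : Fin k → ℂ[X] := chainPoly (fun i => Vᴴ *ᵥ c i) e
  set M : Matrix (Fin k) (Fin k) ℂ[X] := N * U.map C * toPoly D E
  have h2 : C τ • (M *ᵥ q) = -((X : ℂ[X]) ^ (e + 1) • (N *ᵥ (C ∘ w))) := by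
    have := congrArg (fun v => N *ᵥ v) h
    simp only [Matrix.mulVec_neg, Matrix.mulVec_smul, Matrix.mulVec_mulVec, Matrix.mul_add, hN,
      zero_add, Matrix.mul_smul, Matrix.smul_mulVec] at this
    have hq : q = Vᴴ.map C *ᵥ chainPoly c e := (map_C_mulVec_chainPoly _ _ _).symm
    rw [← this, hq, Matrix.mulVec_mulVec]
    simp only [M, Matrix.mul_assoc]
  -- The adjugate stands in for the inverse of `M`; the determinant left over is nonzero at `0`, so
  -- it is coprime to `X ^ (e + 1)` and can be cancelled.
  have h3 : (C τ * M.det) • q =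
      -((X : ℂ[X]) ^ (e + 1) • (M.adjugate *ᵥ (N *ᵥ (C ∘ w)))) := by
    rw [← Matrix.mulVec_smul, ← Matrix.mulVec_neg, ← h2, Matrix.mulVec_smul,
      Matrix.mulVec_mulVec, Matrix.adjugate_mul, Matrix.smul_mulVec, Matrix.one_mulVec, smul_smul]
  have hdet : (C τ * M.det).eval 0 ≠ 0 := by
    have hUC : (U.map C).map (evalRingHom 0) = U := by
      ext i j
      simp
    rw [eval_mul, eval_C, ← coe_evalRingHom, RingHom.map_det, RingHom.mapMatrix_apply,
      Matrix.map_mul, Matrix.map_mul, toPoly_map_eval, hUC, zero_smul, sub_zero, Matrix.det_mul]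
    exact mul_ne_zero hτ (mul_ne_zero hU hD)
  have hcop : IsCoprime ((X : ℂ[X]) ^ (e + 1)) (C τ * M.det) := by
    refine IsCoprime.pow_left ((irreducible_X.coprime_iff_not_dvd).2 fun hdvd => hdet ?_)
    rw [← coeff_zero_eq_eval_zero]
    exact X_dvd_iff.1 hdvd
  funext j
  have hdvd : (X : ℂ[X]) ^ (e + 1) ∣ (C τ * M.det) * q j := by
    have := congrFun h3 j
    simp only [Pi.smul_apply, Pi.neg_apply, smul_eq_mul] at this
    rw [this]
    exact (Dvd.intro _ rfl).neg_right
  -- With `d = e + 1`, the coefficient of `X ^ e` in `q` is `Vᴴ *ᵥ c d`.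
  have := X_pow_dvd_iff.1 (hcop.dvd_of_dvd_mul_left hdvd) e (Nat.lt_succ_self e)
  rwa [coeff_chainPoly _ (Nat.lt_succ_self e)] at this

theorem conjTranspose_perturb {n k : ℕ} (A : Matrix (Fin n) (Fin n) ℂ) (τ : ℂ)
    (U : Matrix (Fin n) (Fin k) ℂ) (D : Matrix (Fin k) (Fin k) ℂ)
    (V : Matrix (Fin n) (Fin k) ℂ) :
    (perturb A τ U D V)ᴴ = perturb Aᴴ (star τ) V Dᴴ U := by
  simp [perturb, Matrix.conjTranspose_mul, Matrix.mul_assoc]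

theorem perturb_sub_smul {n k : ℕ} (A B : Matrix (Fin n) (Fin n) ℂ) (τ μ : ℂ)
    (U : Matrix (Fin n) (Fin k) ℂ) (D E : Matrix (Fin k) (Fin k) ℂ)
    (V : Matrix (Fin n) (Fin k) ℂ) :
    perturb A τ U D V - μ • perturb B τ U E V = perturb (A - μ • B) τ U (D - μ • E) V := by
  simp only [perturb, Matrix.mul_sub, Matrix.sub_mul, smul_sub, smul_add, Matrix.mul_smul,
    Matrix.smul_mul, smul_comm μ τ]
  abel

theorem conjTranspose_mulVec_eq_zero_of_left_chain {n k : ℕ} {A B : Matrix (Fin n) (Fin n) ℂ}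
    {U V : Matrix (Fin n) (Fin k) ℂ} {D E : Matrix (Fin k) (Fin k) ℂ}
    {N : Matrix (Fin k) (Fin n) ℂ[X]} (hN : N * toPoly Aᴴ Bᴴ = 0)
    (hV : (N.map (evalRingHom 0) * V).det ≠ 0) (hD : D.det ≠ 0) {τ : ℂ} (hτ : τ ≠ 0)
    {c : ℕ → Fin n → ℂ} {d : ℕ} (hd : 1 ≤ d) (h1 : star (c 1) ᵥ* perturb A τ U D V = 0)
    (hc : ∀ i, 1 ≤ i → i < d →
      star (c (i + 1)) ᵥ* perturb A τ U D V = star (c i) ᵥ* perturb B τ U E V) :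
    Uᴴ *ᵥ c d = 0 := by
  have hstar : ∀ (F : Matrix (Fin n) (Fin n) ℂ) (G : Matrix (Fin k) (Fin k) ℂ) (x : Fin n → ℂ),
      perturb Fᴴ (star τ) V Gᴴ U *ᵥ x = star (star x ᵥ* perturb F τ U G V) := by
    intro F G x
    rw [← conjTranspose_perturb, Matrix.star_vecMul, star_star]
  refine conjTranspose_mulVec_eq_zero_of_chain (D := Dᴴ) (E := Eᴴ) hN hV ?_
    (star_ne_zero.2 hτ) hd ?_ ?_
  · rw [Matrix.det_conjTranspose]
    exact star_ne_zero.2 hD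
  · rw [hstar, h1, star_zero]
  · intro i hi hi'
    rw [hstar, hstar, hc i hi hi']

/-! ### Genericity -/

/-- A complex-valued function on `ℝ^σ` whose real and imaginary parts are polynomials. -/
def IsPolyFun {σ : Type*} (f : (σ → ℝ) → ℂ) : Prop :=
  ∃ p q : MvPolynomial σ ℝ, ∀ v, f v = ⟨MvPolynomial.eval v p, MvPolynomial.eval v q⟩

namespace IsPolyFun

variable {σ ι : Type*}

theorem const (z : ℂ) : IsPolyFun fun _ : σ → ℝ => z :=
  ⟨MvPolynomial.C z.re, MvPolynomial.C z.im, fun v => by simp⟩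

theorem add {f g : (σ → ℝ) → ℂ} (hf : IsPolyFun f) (hg : IsPolyFun g) :
    IsPolyFun fun v => f v + g v := by
  obtain ⟨p, q, h⟩ := hf
  obtain ⟨p', q', h'⟩ := hg
  exact ⟨p + p', q + q', fun v => by simp only [h, h']; apply Complex.ext <;> simp⟩

theorem mul {f g : (σ → ℝ) → ℂ} (hf : IsPolyFun f) (hg : IsPolyFun g) :
    IsPolyFun fun v => f v * g v := by
  obtain ⟨p, q, h⟩ := hf
  obtain ⟨p', q', h'⟩ := hg
  exact ⟨p * p' - q * q', p * q' + q * p', fun v => by simp only [h, h']; apply Complex.ext <;> simp⟩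

theorem sum (s : Finset ι) {f : ι → (σ → ℝ) → ℂ} (hf : ∀ i, IsPolyFun (f i)) :
    IsPolyFun fun v => ∑ i ∈ s, f i v := by
  classical
  induction s using Finset.induction_on with
  | empty => simpa using const 0
  | insert a s ha ih => simpa only [Finset.sum_insert ha] using (hf a).add ih

theorem prod (s : Finset ι) {f : ι → (σ → ℝ) → ℂ} (hf : ∀ i, IsPolyFun (f i)) :
    IsPolyFun fun v => ∏ i ∈ s, f i v := by
  classical
  induction s using Finset.induction_on with
  | empty => simpa using const 1
  | insert a s ha ih => simpa only [Finset.prod_insert ha] using (hf a).mul ih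

theorem det {k : ℕ} {M : (σ → ℝ) → Matrix (Fin k) (Fin k) ℂ}
    (hM : ∀ i j, IsPolyFun fun v => M v i j) : IsPolyFun fun v => (M v).det := by
  simp only [Matrix.det_apply']
  exact sum _ fun s => (const _).mul (prod _ fun i => hM _ _)

/-- Over the reals, the sum of squares of the real and imaginary parts vanishes exactly when both
do. -/
theorem exists_eval_eq_zero_iff {f : (σ → ℝ) → ℂ} (hf : IsPolyFun f) :
    ∃ p : MvPolynomial σ ℝ, ∀ v, MvPolynomial.eval v p = 0 ↔ f v = 0 := by
  obtain ⟨p, q, h⟩ := hf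
  refine ⟨p * p + q * q, fun v => ?_⟩
  rw [h, Complex.ext_iff]
  simp [mul_self_add_mul_self_eq_zero]

end IsPolyFun

theorem isPolyFun_realCoords_symm {n k : ℕ} (i : Fin n) (j : Fin k) :
    IsPolyFun fun v => (realCoords n k).symm v i j :=
  ⟨MvPolynomial.X (Sum.inl (i, j)), MvPolynomial.X (Sum.inr (i, j)), fun v => by
    simp [realCoords]⟩

theorem isGeneric_setOf_det_mul_ne_zero {ι : Type*} {n k : ℕ} (s : Finset ι)
    (N : ι → Matrix (Fin k) (Fin n) ℂ)
    (hN : ∀ i ∈ s, ∃ W : Matrix (Fin n) (Fin k) ℂ, (N i * W).det ≠ 0) :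
    IsGeneric {U : Matrix (Fin n) (Fin k) ℂ | ∀ i ∈ s, (N i * U).det ≠ 0} := by
  have hpoly : ∀ i, ∃ p : MvPolynomial ((Fin n × Fin k) ⊕ (Fin n × Fin k)) ℝ,
      ∀ v, MvPolynomial.eval v p = 0 ↔ (N i * (realCoords n k).symm v).det = 0 := fun i =>
    (IsPolyFun.det fun a b => by
      simp only [Matrix.mul_apply]
      exact IsPolyFun.sum _ fun l => (IsPolyFun.const _).mul
        (isPolyFun_realCoords_symm l b)).exists_eval_eq_zero_iff
  choose p hp using hpoly
  -- Each factor is nonzero at its witness `W`; the product is the single equation cutting out the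
  -- exceptional set.
  have hne : ∏ i ∈ s, p i ≠ 0 := by
    refine Finset.prod_ne_zero_iff.2 fun i hi h0 => ?_
    obtain ⟨W, hW⟩ := hN i hi
    have := (hp i (realCoords n k W)).1 (by rw [h0, map_zero])
    rw [Equiv.symm_apply_apply] at this
    exact hW this
  refine ⟨{v | MvPolynomial.eval v (∏ i ∈ s, p i) = 0}, ⟨{∏ i ∈ s, p i}, ?_⟩, ?_, ?_⟩
  · ext v
    simp
  · intro huniv
    refine hne (MvPolynomial.funext fun v => ?_)
    rw [map_zero]
    exact huniv.symm.subset (Set.mem_univ v)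
  · intro v hv
    by_contra hcon
    refine hv ⟨(realCoords n k).symm v, fun i hi h0 => hcon ?_, Equiv.apply_symm_apply _ _⟩
    change MvPolynomial.eval v (∏ i ∈ s, p i) = 0
    rw [map_prod]
    exact Finset.prod_eq_zero hi ((hp i v).2 h0)

/-! ### Localisation of a pencil at a point of the Riemann sphere -/

/-- The pencil whose eigenvalue `0` corresponds to the eigenvalue `o` of `A - λ B`,
where `none` stands for `∞`. -/
noncomputable def localPencil {m n : ℕ} (A B : Matrix (Fin m) (Fin n) ℂ) :
    Option ℂ → Matrix (Fin m) (Fin n) ℂ × Matrix (Fin m) (Fin n) ℂ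
  | some μ => (A - μ • B, B)
  | none => (B, A)

theorem rank_localPencil_sub_smul_le {m n r : ℕ} {A B : Matrix (Fin m) (Fin n) ℂ}
    (h : normalRank A B ≤ r) {o : Option ℂ} (ho : (localPencil A B o).1.rank < normalRank A B)
    (ζ : ℂ) : ((localPencil A B o).1 - ζ • (localPencil A B o).2).rank ≤ r := by
  refine le_trans ?_ h
  cases o with
  | some μ =>
    simp only [localPencil]
    rw [sub_sub, ← add_smul]
    exact rank_le_normalRank A B _
  | none =>
    simp only [localPencil] at ho ⊢
    -- At `ζ = 0` the matrix is `B`, not a multiple of any `A - ξ B`; its rank is bounded because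
    -- `∞` is an eigenvalue.
    rcases eq_or_ne ζ 0 with rfl | hζ
    · rw [zero_smul, sub_zero]
      exact ho.le
    · have : B - ζ • A = (-ζ) • (A - ζ⁻¹ • B) := by
        rw [smul_sub, smul_smul, neg_mul, mul_inv_cancel₀ hζ, neg_smul, neg_smul, one_smul]
        abel
      rw [this, Matrix.rank_smul_of_mem_nonZeroDivisors _
        (mem_nonZeroDivisors_of_ne_zero (neg_ne_zero.2 hζ))]
      exact rank_le_normalRank A B _

theorem finite_setOf_rank_localPencil_lt {m n : ℕ} (A B : Matrix (Fin m) (Fin n) ℂ) :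
    {o : Option ℂ | (localPencil A B o).1.rank < normalRank A B}.Finite := by
  refine (((finite_setOf_isFiniteEigenvalue A B).image some).insert none).subset ?_
  rintro (_ | μ) ho
  · exact Set.mem_insert _ _
  · exact Set.mem_insert_of_mem _ ⟨μ, ho, rfl⟩

/-- Regularity forces normal rank `k`, so `F` has full rank. -/
theorem det_ne_zero_of_normalRank_le_rank {k : ℕ} {D E F : Matrix (Fin k) (Fin k) ℂ}
    (hreg : IsRegularPencil D E) (h : normalRank D E ≤ F.rank) : F.det ≠ 0 := by
  obtain ⟨ζ, hζ⟩ := hreg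
  have h1 := (rank_le_normalRank D E ζ).trans h
  rw [Matrix.rank_of_det_ne_zero hζ, Fintype.card_fin] at h1
  have hrange : LinearMap.range F.mulVecLin = ⊤ := by
    refine Submodule.eq_top_of_finrank_eq (le_antisymm (Submodule.finrank_le _) ?_)
    rw [Module.finrank_fin_fun]
    exact h1
  have hunit : IsUnit F := Matrix.mulVec_surjective_iff_isUnit.1 (LinearMap.range_eq_top.1 hrange)
  exact ((Matrix.isUnit_iff_isUnit_det F).1 hunit).ne_zero

/-- For finitely many `n × n` pencils of normal rank at most `n - k` and a generic `n × k` matrix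
`U`, each pencil has `k` polynomial left null vectors whose values at `0` are independent on the
column space of `U`. -/
theorem exists_generic_left_kernel {ι : Type*} {n k : ℕ} (s : Finset ι)
    (S T : ι → Matrix (Fin n) (Fin n) ℂ)
    (h : ∀ i ∈ s, ∀ ζ : ℂ, (S i - ζ • T i).rank + k ≤ n) :
    ∃ Ω : Set (Matrix (Fin n) (Fin k) ℂ), IsGeneric Ω ∧ ∀ U ∈ Ω, ∀ i ∈ s,
      ∃ N : Matrix (Fin k) (Fin n) ℂ[X], N * toPoly (S i) (T i) = 0 ∧
        (N.map (evalRingHom 0) * U).det ≠ 0 := by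
  have h' : ∀ i, ∃ N : Matrix (Fin k) (Fin n) ℂ[X], i ∈ s → N * toPoly (S i) (T i) = 0 ∧
      ∃ W : Matrix (Fin n) (Fin k) ℂ, (N.map (evalRingHom 0) * W).det ≠ 0 := by
    intro i
    by_cases hi : i ∈ s
    · obtain ⟨N, hN⟩ := exists_polynomial_left_kernel (S i) (T i) (h i hi)
      exact ⟨N, fun _ => hN⟩
    · exact ⟨0, fun hi' => absurd hi' hi⟩
  choose N hN using h'
  exact ⟨_, isGeneric_setOf_det_mul_ne_zero s (fun i => (N i).map (evalRingHom 0))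
    fun i hi => (hN i hi).2, fun U hU i hi => ⟨N i, (hN i hi).1, hU i hi⟩⟩

open scoped ComplexOrder in
theorem rank_conjTranspose_sub_smul {m n : ℕ} (A B : Matrix (Fin m) (Fin n) ℂ) (ζ : ℂ) :
    (Aᴴ - ζ • Bᴴ).rank = (A - star ζ • B).rank := by
  rw [← Matrix.rank_conjTranspose (A - star ζ • B), Matrix.conjTranspose_sub,
    Matrix.conjTranspose_smul, star_star]

theorem det_localPencil_ne_zero {n k : ℕ} {A B : Matrix (Fin n) (Fin n) ℂ}
    {D E : Matrix (Fin k) (Fin k) ℂ} (hreg : IsRegularPencil D E)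
    (hdisj : DisjointEigenvalues D E A B) {o : Option ℂ}
    (ho : (localPencil A B o).1.rank < normalRank A B) : (localPencil D E o).1.det ≠ 0 := by
  refine det_ne_zero_of_normalRank_le_rank hreg (not_lt.1 fun hlt => ?_)
  cases o with
  | some μ => exact hdisj.1 μ ⟨hlt, ho⟩
  | none => exact hdisj.2 ⟨hlt, ho⟩

end MatrixPencil

/-! ### Assembly over all eigenvalues -/

theorem corollary3p6 (n k : ℕ) (A B : Matrix (Fin n) (Fin n) ℂ)
    (hsing : IsSingularPencil A B) (hrank : normalRank A B + k = n)
    (DA DB : Matrix (Fin k) (Fin k) ℂ) (hDA : DA.IsDiag) (hDB : DB.IsDiag)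
    (hD : IsRegularPencil DA DB) (hdisj : DisjointEigenvalues DA DB A B) :
    ∃ Ω₂ : Set (Matrix (Fin n) (Fin k) ℂ), IsGeneric Ω₂ ∧ ∀ U ∈ Ω₂,
      ∃ Ω₃ : Set (Matrix (Fin n) (Fin k) ℂ), IsGeneric Ω₃ ∧ ∀ V ∈ Ω₃,
        ∀ τ : ℂ, τ ≠ 0 →
          (∀ μ : ℂ, IsFiniteEigenvalue A B μ → ∀ d : ℕ, 1 ≤ d →
            (∀ x : Fin n → ℂ,
              IsRightRootVector (perturb A τ U DA V) (perturb B τ U DB V) μ d x →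
                Vᴴ *ᵥ x = 0) ∧
            (∀ y : Fin n → ℂ,
              IsLeftRootVector (perturb A τ U DA V) (perturb B τ U DB V) μ d y →
                Uᴴ *ᵥ y = 0)) ∧
          (IsInfiniteEigenvalue A B → ∀ d : ℕ, 1 ≤ d →
            (∀ x : Fin n → ℂ,
              IsRightRootVectorInfty (perturb A τ U DA V) (perturb B τ U DB V) d x →
                Vᴴ *ᵥ x = 0) ∧
            (∀ y : Fin n → ℂ,
              IsLeftRootVectorInfty (perturb A τ U DA V) (perturb B τ U DB V) d y →
                Uᴴ *ᵥ y = 0)) := by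
  have hfin := finite_setOf_rank_localPencil_lt A B
  have hmem : ∀ o, o ∈ hfin.toFinset → (localPencil A B o).1.rank < normalRank A B :=
    fun o ho => hfin.mem_toFinset.1 ho
  have hle : normalRank A B ≤ n - k := by omega
  have hrk : ∀ o ∈ hfin.toFinset, ∀ ζ : ℂ,
      ((localPencil A B o).1 - ζ • (localPencil A B o).2).rank + k ≤ n := by
    intro o ho ζ
    have := rank_localPencil_sub_smul_le hle (hmem o ho) ζ
    omega
  obtain ⟨Ω₂, hΩ₂, hU⟩ := exists_generic_left_kernel (k := k) hfin.toFinset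
    (fun o => (localPencil A B o).1) (fun o => (localPencil A B o).2) hrk
  -- For the conjugate-transposed pencils `V` plays the part of `U`, so this set does not depend on
  -- `U`.
  obtain ⟨Ω₃, hΩ₃, hV⟩ := exists_generic_left_kernel (k := k) hfin.toFinset
    (fun o => (localPencil A B o).1ᴴ) (fun o => (localPencil A B o).2ᴴ) (by
      intro o ho ζ
      rw [rank_conjTranspose_sub_smul]
      exact hrk o ho _)
  refine ⟨Ω₂, hΩ₂, fun U hUΩ => ⟨Ω₃, hΩ₃, fun V hVΩ τ hτ => ⟨?_, ?_⟩⟩⟩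
  · intro μ hμ d hd
    have ho : some μ ∈ hfin.toFinset := hfin.mem_toFinset.2 hμ
    have hdet := det_localPencil_ne_zero hD hdisj (hmem _ ho)
    constructor
    · rintro _ ⟨c, rfl, -, h1, hc⟩
      obtain ⟨N, hN, hNU⟩ := hU U hUΩ _ ho
      -- Shifting by `μ` commutes with perturbing: the chain becomes one at `0` for the perturbed
      -- local pencil.
      rw [perturb_sub_smul] at h1 hc
      exact conjTranspose_mulVec_eq_zero_of_chain hN hNU hdet hτ hd h1 hc
    · rintro _ ⟨c, rfl, -, h1, hc⟩
      obtain ⟨N, hN, hNV⟩ := hV V hVΩ _ ho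
      rw [perturb_sub_smul] at h1 hc
      exact conjTranspose_mulVec_eq_zero_of_left_chain hN hNV hdet hτ hd h1 hc
  · intro hinf d hd
    have ho : none ∈ hfin.toFinset := hfin.mem_toFinset.2 hinf
    have hdet := det_localPencil_ne_zero hD hdisj (hmem _ ho)
    constructor
    · rintro _ ⟨c, rfl, -, h1, hc⟩
      obtain ⟨N, hN, hNU⟩ := hU U hUΩ _ ho
      exact conjTranspose_mulVec_eq_zero_of_chain hN hNU hdet hτ hd h1 hc
    · rintro _ ⟨c, rfl, -, h1, hc⟩
      obtain ⟨N, hN, hNV⟩ := hV V hVΩ _ ho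
      exact conjTranspose_mulVec_eq_zero_of_left_chain hN hNV hdet hτ hd h1 hc
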